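/- Let $X$ be a complex Banach space and let $A$, $B$ be closed, densely defined linear operators on $X$ generating strongly continuous semigroups $(T(t))_{t\ge 0}$ and $(S(t))_{t\ge0}$. Suppose that $A+B$, with domain $D(A)\cap D(B)$, is closable and that its closure generates a strongly continuous semigroup $(U(t))_{t\ge 0}$. Let $X_m$ ($m\in\mathbb N$) be complex Banach spaces and let $P_m\colon X\to X_m$, $J_m\colon X_m\to X$ be bounded linear operators such that $P_mJ_m=I_m$ (the identity of $X_m$) for all $m$, $J_mP_mx\to x$ as $m\to\infty$ for all $x\in X$, and $\|J_m\|\le K$, $\|P_m\|\le K$ for all $m$ with a constant $K$. Let $A_m$, $B_m$ be (possibly unbounded) linear operators on $X_m$ such that: (i) there is a constant $M_0$ such that every $\lambda\in\mathbb C$ with $\operatorname{Re}\lambda>0$ lies in the resolvent sets of $A$, $B$, $A_m$, $B_m$ for all $m$, and $\|\operatorname{Re}\lambda\, R(\lambda,C)\|\le M_0$ for each $C\in\{A,B\}\cup\{A_m,B_m: m\in\mathbb N\}$, where $R(\lambda,C)=(\lambda-C)^{-1}$; (ii) $P_mD(A)\subset D(A_m)$, $P_mD(B)\subset D(B_m)$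 for all $m$, and $\lim_{m\to\infty}J_mA_mP_mx=Ax$ for all $x\in D(A)$, $\lim_{m\to\infty}J_mB_mP_mx=Bx$ for all $x\in D(B)$. Let $r$ and $q$ be complex rational functions that are bounded (in particular have no poles) on the closed left half-plane $\{z\in\mathbb C:\operatorname{Re}z\le0\}$, with $r(0)=r'(0)=1$ and $q(0)=q'(0)=1$. For $h\ge0$ the bounded operator $r(hA_m)$ on $X_m$ is defined by inserting $hA_m$ into the partial fraction decomposition of $r$: if $r(z)=c_0+\sum_{i}\sum_{j}c_{ij}(1-z/\lambda_i)^{-j}$, where $\lambda_i$ are the poles of $r$, then $r(hA_m)=c_0I_m+\sum_i\sum_jc_{ij}\bigl[(I_m-\tfrac{h}{\lambda_i}A_m)^{-1}\bigr]^{j}$, so that $r(0A_m)=I_m$; $q(hB_m)$ is defined in the same way. (Strang splitting) If there are constants $M,\omega\in\mathbb R$ such that $$\bigl\|[r(\tfrac h2A_m)\,q(hB_m)\,r(\tfrac h2A_m)]^k\bigr\|\le Me^{kh\omega}\qquad\text{for all } h\ge0,\ k,m\in\mathbb N,$$ then for all $t\ge0$ and $x\in X$ $$\lim_{m,n\to\infty}J_m\bigl[r(\tfrac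 t{2n}A_m)\,q(\tfrac tnB_m)\,r(\tfrac t{2n}A_m)\bigr]^nP_mx=U(t)x.$$ (Weighted splitting) If $\Theta\in[0,1]$ and there are constants $M,\omega\in\mathbb R$ such that $$\bigl\|[\Theta\,q(hB_m)r(hA_m)+(1-\Theta)\,r(hA_m)q(hB_m)]^k\bigr\|\le Me^{kh\omega}\qquad\text{for all } h\ge0,\ k,m\in\mathbb N,$$ then for all $t\ge0$ and $x\in X$ $$\lim_{m,n\to\infty}J_m\bigl[\Theta\,q(\tfrac tnB_m)r(\tfrac tnA_m)+(1-\Theta)\,r(\tfrac tnA_m)q(\tfrac tnB_m)\bigr]^nP_mx=U(t)x.$$ Here $\lim_{m,n\to\infty}a_{m,n}=a$ means that for every $\varepsilon>0$ there is $N$ with $\|a_{m,n}-a\|\le\varepsilon$ for all $m,n\ge N$. -/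

import Mathlib

open Filter Topology

namespace Splitting

section Semigroups

variable {E : Type*} [NormedAddCommGroup E] [NormedSpace ℂ E]

/-- `T` is a strongly continuous one-parameter semigroup of bounded operators on `E`
(only the values `T t` for `t ≥ 0` matter). -/
structure IsC0Semigroup (T : ℝ → E →L[ℂ] E) : Prop where
  map_zero : T 0 = 1
  map_add : ∀ s t : ℝ, 0 ≤ s → 0 ≤ t → T (s + t) = T s * T t
  continuousOn : ∀ x : E, ContinuousOn (fun t => T t x) (Set.Ici 0)

/-- `A` is the (infinitesimal) generator of `T`: a vector `x` lies in `D(A)` with `A x = y`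
exactly if `(T h x - x) / h → y` as `h ↓ 0`. -/
def IsGenerator (A : E →ₗ.[ℂ] E) (T : ℝ → E →L[ℂ] E) : Prop :=
  ∀ x y : E, (x, y) ∈ A.graph ↔
    Tendsto (fun h : ℝ => (h : ℂ)⁻¹ • (T h x - x)) (𝓝[>] 0) (𝓝 y)

/-- `R` is a bounded, everywhere defined two-sided inverse of `μ - A : D(A) → E`. -/
def IsResolventAt (A : E →ₗ.[ℂ] E) (μ : ℂ) (R : E →L[ℂ] E) : Prop :=
  (∀ x : A.domain, R (μ • (x : E) - A x) = x) ∧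
    ∀ y : E, ∃ hy : R y ∈ A.domain, μ • R y - A ⟨R y, hy⟩ = y

/-- The resolvent set `ρ(A)` of an unbounded operator. -/
def rho (A : E →ₗ.[ℂ] E) : Set ℂ := {μ | ∃ R : E →L[ℂ] E, IsResolventAt A μ R}

open Classical in
/-- The resolvent `R(μ, A) = (μ - A)⁻¹` for `μ ∈ ρ(A)` (and `0` otherwise). -/
noncomputable def res (A : E →ₗ.[ℂ] E) (μ : ℂ) : E →L[ℂ] E :=
  if h : μ ∈ rho A then h.choose else 0

theorem IsResolventAt.unique {A : E →ₗ.[ℂ] E} {μ : ℂ} {R R' : E →L[ℂ] E}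
    (h : IsResolventAt A μ R) (h' : IsResolventAt A μ R') : R = R' := by
  ext y
  obtain ⟨hy, e⟩ := h'.2 y
  have := h.1 ⟨R' y, hy⟩
  rw [e] at this
  exact this

theorem isResolventAt_res {A : E →ₗ.[ℂ] E} {μ : ℂ} (h : μ ∈ rho A) :
    IsResolventAt A μ (res A μ) := by
  rw [res, dif_pos h]
  exact h.choose_spec

/-- The open right half-plane lies in `ρ(A)`, and `‖Re μ · R(μ, A)‖ ≤ M` there. -/
def ResolventBound (A : E →ₗ.[ℂ] E) (M : ℝ) : Prop :=
  ∀ μ : ℂ, 0 < μ.re → μ ∈ rho A ∧ ‖(μ.re : ℂ) • res A μ‖ ≤ M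

/-- The bounded operator `(I - s A)⁻¹`, that is `s⁻¹ R(s⁻¹, A)` for `s ≠ 0`, and `I` for `s = 0`. -/
noncomputable def invOneSub (A : E →ₗ.[ℂ] E) (s : ℂ) : E →L[ℂ] E :=
  if s = 0 then 1 else s⁻¹ • res A s⁻¹

end Semigroups

section RationalFunctions

/-- The value `r(z)` of a rational function (`num`, `denom` are coprime, so that the poles are
exactly the zeros of `denom`). -/
noncomputable def value (r : RatFunc ℂ) (z : ℂ) : ℂ := r.eval (RingHom.id ℂ) z

/-- `r(0) = r'(0) = 1`. -/
def ApproximatesExp (r : RatFunc ℂ) : Prop :=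
  value r 0 = 1 ∧ HasDerivAt (value r) 1 0

/-- `r` has no poles in the closed left half-plane `{z | Re z ≤ 0}` and is bounded there. -/
def BoundedOnLeftHalfPlane (r : RatFunc ℂ) : Prop :=
  ∃ C : ℝ, ∀ z : ℂ, z.re ≤ 0 → r.denom.eval z ≠ 0 ∧ ‖value r z‖ ≤ C

/-- The partial fraction decomposition
`r(z) = c₀ + ∑_{p pole of r} ∑_{1 ≤ j ≤ order of p} c_{p,j} / (1 - z/p)^j`
(the coefficient `c_{p,j+1}` is stored as `c p j`). -/
def IsPartialFraction (r : RatFunc ℂ) (c₀ : ℂ) (c : ℂ → ℕ → ℂ) : Prop :=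
  ∀ z : ℂ, r.denom.eval z ≠ 0 →
    value r z = c₀ + ∑ p ∈ r.denom.roots.toFinset,
      ∑ j ∈ Finset.range (r.denom.rootMultiplicity p), c p j * ((1 - z / p)⁻¹) ^ (j + 1)

/-- The operator `c₀ + ∑_p ∑_j c_{p,j} ((I - (h/p) A)⁻¹)^j`. -/
noncomputable def partialFractionOp {E : Type*} [NormedAddCommGroup E] [NormedSpace ℂ E]
    (r : RatFunc ℂ) (c₀ : ℂ) (c : ℂ → ℕ → ℂ) (h : ℝ) (A : E →ₗ.[ℂ] E) : E →L[ℂ] E :=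
  c₀ • 1 + ∑ p ∈ r.denom.roots.toFinset,
    ∑ j ∈ Finset.range (r.denom.rootMultiplicity p), c p j • (invOneSub A (h / p)) ^ (j + 1)

open Classical in
/-- The bounded operator `r(hA)`, `h ≥ 0`, obtained by inserting `hA` into the partial fraction
decomposition of `r`. By `exists_isPartialFraction` and `ratOp_eq` below, the decomposition exists
if `r` is bounded on the closed left half-plane, and `r(hA)` does not depend on any choice. -/
noncomputable def ratOp {E : Type*} [NormedAddCommGroup E] [NormedSpace ℂ E]
    (r : RatFunc ℂ) (h : ℝ) (A : E →ₗ.[ℂ] E) : E →L[ℂ] E :=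
  if H : ∃ c : ℂ × (ℂ → ℕ → ℂ), IsPartialFraction r c.1 c.2 then
    partialFractionOp r H.choose.1 H.choose.2 h A
  else 0

open Polynomial in
theorem denom_eq_prod (r : RatFunc ℂ) : r.denom =
    ∏ p ∈ r.denom.roots.toFinset, (X - C p) ^ r.denom.rootMultiplicity p := by
  conv_lhs => rw [(IsAlgClosed.splits r.denom).eq_prod_roots_of_monic r.monic_denom]
  exact prod_multiset_root_eq_finset_root

open Polynomial in
/-- Multiplying out `q + ∑_p ∑_j c_{p,j} / (1 - z/p)^j`. -/
theorem partialFraction_mul (r : RatFunc ℂ) (h0 : r.denom.eval 0 ≠ 0) (q : ℂ[X])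
    (c : ℂ → ℕ → ℂ) (z : ℂ) (hz : r.denom.eval z ≠ 0) :
    (q.eval z + ∑ p ∈ r.denom.roots.toFinset,
      ∑ j ∈ Finset.range (r.denom.rootMultiplicity p), c p j * ((1 - z / p)⁻¹) ^ (j + 1)) *
        r.denom.eval z =
    (q * (∏ p ∈ r.denom.roots.toFinset, (X - C p) ^ r.denom.rootMultiplicity p) +
      ∑ p ∈ r.denom.roots.toFinset, ∑ j : Fin (r.denom.rootMultiplicity p),
        C (c p j.rev * (-p) ^ (j.rev.1 + 1)) * (X - C p) ^ j.1 *
          ∏ k ∈ r.denom.roots.toFinset.erase p,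
            (X - C k) ^ r.denom.rootMultiplicity k).eval z := by
  rw [← denom_eq_prod, eval_add, eval_mul, add_mul, add_right_inj, Finset.sum_mul, eval_finsetSum]
  refine Finset.sum_congr rfl fun p hp => ?_
  have hp' : r.denom.eval p = 0 := by
    have := Multiset.mem_toFinset.1 hp
    exact (mem_roots'.1 this).2
  have hp0 : p ≠ 0 := by rintro rfl; exact h0 hp'
  have hzp : z - p ≠ 0 := by
    intro e; rw [sub_eq_zero] at e; subst e; exact hz hp'
  rw [Finset.sum_range, ← Equiv.sum_comp Fin.revPerm, Finset.sum_mul, eval_finsetSum]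
  refine Finset.sum_congr rfl fun j _ => ?_
  have hD : r.denom.eval z = (z - p) ^ r.denom.rootMultiplicity p *
      ∏ k ∈ r.denom.roots.toFinset.erase p, (z - k) ^ r.denom.rootMultiplicity k := by
    conv_lhs => rw [denom_eq_prod]
    rw [← Finset.mul_prod_erase _ _ hp, eval_mul, eval_prod]
    simp
  have hinv : (1 - z / p)⁻¹ = -p * (z - p)⁻¹ := by
    have : 1 - z / p ≠ 0 := by
      intro e
      apply hzp
      field_simp at e
      linear_combination -e
    rw [inv_eq_iff_eq_inv, mul_inv, inv_inv]
    field_simp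
    ring
  rw [hD, hinv, mul_pow]
  simp only [Fin.revPerm_apply, eval_mul, eval_C, eval_pow, eval_sub, eval_X, eval_prod]
  have hn : r.denom.rootMultiplicity p = (j.rev.1 + 1) + j.1 := by
    rw [Fin.val_rev]; omega
  have : (z - p)⁻¹ ^ (j.rev.1 + 1) * (z - p) ^ r.denom.rootMultiplicity p = (z - p) ^ j.1 := by
    have e : (z - p) ^ r.denom.rootMultiplicity p = (z - p) ^ ((j.rev.1 + 1) + j.1) :=
      congrArg _ hn
    rw [e, pow_add (z - p), ← mul_assoc, ← mul_pow, inv_mul_cancel₀ hzp, one_pow, one_mul]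
  rw [← this]
  ring

open Polynomial in
theorem pairwise_coprime (r : RatFunc ℂ) :
    Set.Pairwise (r.denom.roots.toFinset : Set ℂ)
      fun i j => IsCoprime (X - C i : ℂ[X]) (X - C j) :=
  fun _ _ _ _ hij => isCoprime_X_sub_C_of_isUnit_sub (sub_ne_zero.2 hij).isUnit

open Polynomial in
/-- A rational function that is bounded on the closed left half-plane has a partial fraction
decomposition without polynomial part of positive degree. -/
theorem exists_isPartialFraction {r : RatFunc ℂ} (hr : BoundedOnLeftHalfPlane r) :
    ∃ (c₀ : ℂ) (c : ℂ → ℕ → ℂ), IsPartialFraction r c₀ c := by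
  classical
  obtain ⟨B, hB⟩ := hr
  have h0 : r.denom.eval 0 ≠ 0 := (hB 0 (by simp)).1
  obtain ⟨q, s, hs, e⟩ := eq_quo_mul_prod_pow_add_sum_rem_mul_prod_pow r.num
    (fun p (_ : p ∈ r.denom.roots.toFinset) => monic_X_sub_C p) (pairwise_coprime r)
    (fun p => r.denom.rootMultiplicity p)
  have hroot : ∀ p ∈ r.denom.roots.toFinset, p ≠ 0 := by
    rintro p hp rfl
    exact h0 (mem_roots'.1 (Multiset.mem_toFinset.1 hp)).2
  let c : ℂ → ℕ → ℂ := fun p j =>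
    if hj : j < r.denom.rootMultiplicity p then
      (s p (Fin.rev ⟨j, hj⟩)).coeff 0 * ((-p) ^ (j + 1))⁻¹ else 0
  have key : ∀ z, r.denom.eval z ≠ 0 → value r z = q.eval z + ∑ p ∈ r.denom.roots.toFinset,
      ∑ j ∈ Finset.range (r.denom.rootMultiplicity p), c p j * ((1 - z / p)⁻¹) ^ (j + 1) := by
    intro z hz
    rw [← mul_left_inj' hz, partialFraction_mul r h0 q c z hz]
    have : value r z * r.denom.eval z = r.num.eval z := by
      rw [value, RatFunc.eval, eval₂_id, eval₂_id, div_mul_cancel₀ _ hz]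
    rw [this, e]
    refine congrArg (eval z) (congrArg (q * (∏ p ∈ r.denom.roots.toFinset,
      (X - C p) ^ r.denom.rootMultiplicity p) + ·) ?_)
    refine Finset.sum_congr rfl fun p hp => Finset.sum_congr rfl fun j _ => ?_
    refine congrArg (fun w : ℂ[X] => w * (X - C p) ^ j.1 *
      ∏ k ∈ r.denom.roots.toFinset.erase p, (X - C k) ^ r.denom.rootMultiplicity k) ?_
    have hd : (s p j).degree ≤ 0 := by
      have := hs p hp j
      rw [degree_X_sub_C] at this
      exact Order.le_of_lt_succ this
    refine (eq_C_of_degree_le_zero hd).trans (congrArg C ?_)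
    have hne : (-p) ^ (j.rev.1 + 1) ≠ 0 := pow_ne_zero _ (neg_ne_zero.2 (hroot p hp))
    simp only [c, Fin.is_lt, dif_pos, Fin.eta, Fin.rev_rev]
    rw [mul_assoc, inv_mul_cancel₀ hne, mul_one]
  have hconst : q.degree ≤ 0 := by
    by_contra hq
    push Not at hq
    have hz : Tendsto (fun x : ℝ => ‖(-x : ℂ)‖) atTop atTop := by
      simpa using tendsto_abs_atTop_atTop (G := ℝ)
    have h1 := q.tendsto_norm_atTop hq hz
    have h2 : Tendsto (fun x : ℝ => ∑ p ∈ r.denom.roots.toFinset,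
        ∑ j ∈ Finset.range (r.denom.rootMultiplicity p),
          c p j * ((1 - (-x : ℂ) / p)⁻¹) ^ (j + 1)) atTop
        (𝓝 (∑ p ∈ r.denom.roots.toFinset,
          ∑ j ∈ Finset.range (r.denom.rootMultiplicity p), c p j * 0 ^ (j + 1))) := by
      refine tendsto_finsetSum _ fun p hp => tendsto_finsetSum _ fun j _ =>
        tendsto_const_nhds.mul (Tendsto.pow ?_ _)
      refine tendsto_inv₀_cobounded.comp ?_
      rw [← tendsto_norm_atTop_iff_cobounded]
      have hp0 : 0 < ‖p‖⁻¹ := inv_pos.2 (norm_pos_iff.2 (hroot p hp))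
      refine tendsto_atTop_mono (fun x => ?_)
        (tendsto_atTop_add_const_right _ (-1) (hz.const_mul_atTop hp0))
      have := norm_sub_norm_le (-x / p : ℂ) 1
      rw [norm_sub_rev, norm_div, norm_one] at this
      rw [inv_mul_eq_div]
      exact this
    have h3 := h2.norm.isBoundedUnder_le
    obtain ⟨b, hb⟩ := h3.eventually_le
    obtain ⟨x, hx0, hx1, hx2⟩ := ((eventually_ge_atTop 0).and
      ((h1.eventually_gt_atTop (B + b)).and hb)).exists
    obtain ⟨hx3, hx4⟩ := hB (-x) (by simpa using hx0)
    rw [key _ hx3] at hx4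
    have := norm_le_add_norm_add (q.eval (-x : ℂ)) (∑ p ∈ r.denom.roots.toFinset,
        ∑ j ∈ Finset.range (r.denom.rootMultiplicity p),
          c p j * ((1 - (-x : ℂ) / p)⁻¹) ^ (j + 1))
    linarith
  refine ⟨q.coeff 0, c, fun z hz => ?_⟩
  rw [key z hz]
  congr 1
  conv_lhs => rw [eq_C_of_degree_le_zero hconst, eval_C]

open Polynomial in
/-- The operator `r(hA)` can be computed from any partial fraction decomposition of `r`. -/
theorem ratOp_eq {E : Type*} [NormedAddCommGroup E] [NormedSpace ℂ E] {r : RatFunc ℂ}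
    (h0 : r.denom.eval 0 ≠ 0) {c₀ : ℂ} {c : ℂ → ℕ → ℂ} (hc : IsPartialFraction r c₀ c)
    (h : ℝ) (A : E →ₗ.[ℂ] E) : ratOp r h A = partialFractionOp r c₀ c h A := by
  classical
  have H : ∃ c : ℂ × (ℂ → ℕ → ℂ), IsPartialFraction r c.1 c.2 := ⟨(c₀, c), hc⟩
  rw [ratOp, dif_pos H]
  have hd := H.choose_spec
  generalize H.choose = d at hd
  have hinf : {z | r.denom.eval z ≠ 0}.Infinite := by
    have : {z | r.denom.eval z = 0}.Finite := r.denom.roots.toFinset.finite_toSet.subset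
      fun z hz => by simpa [r.denom_ne_zero] using hz
    exact this.infinite_compl
  have hpoly := eq_of_infinite_eval_eq _ _ (hinf.mono fun z hz => by
    refine (partialFraction_mul r h0 (C d.1) d.2 z hz).symm.trans
      (Eq.trans ?_ (partialFraction_mul r h0 (C c₀) c z hz))
    rw [eval_C, eval_C, ← hd z hz, ← hc z hz])
  have hroot : ∀ p ∈ r.denom.roots.toFinset, p ≠ 0 := by
    rintro p hp rfl
    exact h0 (mem_roots'.1 (Multiset.mem_toFinset.1 hp)).2
  have hdeg : ∀ (a p : ℂ), (C a).degree < (X - C p).degree := fun a p => by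
    rw [degree_X_sub_C]
    exact degree_C_le.trans_lt zero_lt_one
  obtain ⟨h1, h2⟩ := quo_mul_prod_pow_add_sum_rem_mul_prod_pow_unique
    (fun p (_ : p ∈ r.denom.roots.toFinset) => monic_X_sub_C p) (pairwise_coprime r)
    (fun p _ j => hdeg _ p) (fun p _ j => hdeg _ p) hpoly
  rw [partialFractionOp, partialFractionOp, C_injective h1]
  refine congrArg (c₀ • 1 + ·) ?_
  refine Finset.sum_congr rfl fun p hp => Finset.sum_congr rfl fun j hj => ?_
  have := congrFun (h2 p hp) (Fin.rev ⟨j, Finset.mem_range.1 hj⟩)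
  have := C_injective this
  rw [Fin.rev_rev] at this
  rw [mul_right_cancel₀ (pow_ne_zero _ (neg_ne_zero.2 (hroot p hp))) this]

end RationalFunctions

end Splitting

open Splitting

/-! The argument is Chernoff's product formula, carried out on the varying spaces `Y m`. Elements `y
i` are compared with `x` through `‖y i - P i x‖ → 0`, along the joint filter in `(m, n)`, so no
relation between mesh and step size is needed. Since stability of one splitting step `V` is assumed,
two things remain.

Consistency: `(V - 1) / h` must converge to `A + B` on `D(A) ∩ D(B)`. Each factor `(I - (h/p)
A_m)⁻¹` is bounded uniformly in `h` and `m` because `Re p > 0`; it tends to the identity and its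
difference quotient tends to `p⁻¹ A`. A product rule (`ConsistentAt.mul`) handles powers and
compositions, and the conditions `r(0) = r'(0) = 1` make the partial fraction coefficients add up to
`A` (`consistentAt_ratOp`).

Convergence (`dConv_pow_of_consistentAt`): stability gives resolvents `R i` of `(V i - 1) / h i` at
`λ = 2ω + 1` with `‖R i‖ ≤ M`. The error `R i (P i (λ a - b)) - P i a` is linear and uniformly
bounded in `(a, b)` and vanishes in the limit on the graph of `A + B`, hence on the graph of the
generator `C`. For `x ∈ D(C²)` and `w = (λ - C) x`, the vectors `R i (P i (U(kh) w))` start near `P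
i x`, end near `P i (U(t) x)`, and `V i` carries each to the next up to `o(h)` uniformly for `kh ≤
t`. Stability sums these defects to `n · o(h) = o(1)`, and density of `D(C²)` finishes the proof. -/

namespace Splitting

/-! ### Discrete convergence and the calculus of consistent operators. -/

section DiscreteConvergence

/-- On a family of uniformly bounded operators, pointwise convergence to zero passes to closures. -/
theorem tendsto_norm_zero_of_mem_closure {ι : Type*} {l : Filter ι} {E : Type*}
    [NormedAddCommGroup E] [NormedSpace ℂ E] {F : ι → Type*} [∀ i, NormedAddCommGroup (F i)]
    [∀ i, NormedSpace ℂ (F i)] {Q : ∀ i, E →L[ℂ] F i} {C : ℝ} (hQ : ∀ᶠ i in l, ‖Q i‖ ≤ C)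
    {D : Set E} (hD : ∀ x ∈ D, Tendsto (fun i => ‖Q i x‖) l (𝓝 0)) {x : E}
    (hx : x ∈ closure D) : Tendsto (fun i => ‖Q i x‖) l (𝓝 0) := by
  rw [Metric.tendsto_nhds]
  intro ε hε
  -- `C` may be zero, or even negative if `l` is trivial; `|C| + 1` is a safe divisor.
  have hC : 0 < |C| + 1 := by positivity
  obtain ⟨d, hd, hxd⟩ := Metric.mem_closure_iff.1 hx (ε / 2 / (|C| + 1)) (by positivity)
  filter_upwards [hQ, (hD d hd).eventually_lt_const (half_pos hε)] with i hi hi'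
  rw [dist_eq_norm, lt_div_iff₀ hC] at hxd
  rw [dist_zero_right, norm_norm]
  have h1 : ‖Q i x‖ ≤ ‖Q i (x - d)‖ + ‖Q i d‖ := by
    rw [map_sub]; simpa using norm_add_le (Q i x - Q i d) (Q i d)
  have h2 : ‖Q i (x - d)‖ ≤ (|C| + 1) * ‖x - d‖ :=
    (Q i).le_of_opNorm_le (hi.trans (by linarith [le_abs_self C])) _
  linarith

/-- On a family of uniformly bounded operators, pointwise convergence to zero is uniform on
compact sets. -/
theorem eventually_forall_norm_lt_of_isCompact {ι : Type*} {l : Filter ι} {E : Type*}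
    [NormedAddCommGroup E] [NormedSpace ℂ E] {F : ι → Type*} [∀ i, NormedAddCommGroup (F i)]
    [∀ i, NormedSpace ℂ (F i)] {Q : ∀ i, E →L[ℂ] F i} {C : ℝ} (hQ : ∀ᶠ i in l, ‖Q i‖ ≤ C)
    {S : Set E} (hS : IsCompact S) (hD : ∀ x ∈ S, Tendsto (fun i => ‖Q i x‖) l (𝓝 0))
    {ε : ℝ} (hε : 0 < ε) : ∀ᶠ i in l, ∀ x ∈ S, ‖Q i x‖ < ε := by
  have hC : 0 < |C| + 1 := by positivity
  obtain ⟨D, hDS, hfin, hcov⟩ := hS.finite_cover_balls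
    (e := ε / 2 / (|C| + 1)) (by positivity)
  have hall : ∀ᶠ i in l, ∀ d ∈ D, ‖Q i d‖ < ε / 2 :=
    hfin.eventually_all.2 fun d hd => (hD d (hDS hd)).eventually_lt_const (half_pos hε)
  filter_upwards [hQ, hall] with i hi hi' x hx
  obtain ⟨d, hd, hxd⟩ := Set.mem_iUnion₂.1 (hcov hx)
  rw [Metric.mem_ball, dist_eq_norm, lt_div_iff₀ hC] at hxd
  have h1 : ‖Q i x‖ ≤ ‖Q i (x - d)‖ + ‖Q i d‖ := by
    rw [map_sub]; simpa using norm_add_le (Q i x - Q i d) (Q i d)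
  have h2 : ‖Q i (x - d)‖ ≤ (|C| + 1) * ‖x - d‖ :=
    (Q i).le_of_opNorm_le (hi.trans (by linarith [le_abs_self C])) _
  linarith [hi' d hd]

variable {ι : Type*} {X : Type*} [NormedAddCommGroup X] [NormedSpace ℂ X]
  {Y : ι → Type*} [∀ i, NormedAddCommGroup (Y i)] [∀ i, NormedSpace ℂ (Y i)]

/-- Discrete convergence of `y i : Y i` to `x : X` with respect to the projections `P`. -/
def DConv (l : Filter ι) (P : ∀ i, X →L[ℂ] Y i) (y : ∀ i, Y i) (x : X) : Prop :=
  Tendsto (fun i => ‖y i - P i x‖) l (𝓝 0)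

/-- The operators `G i` converge discretely to the identity. -/
def TendstoId (l : Filter ι) (P : ∀ i, X →L[ℂ] Y i) (G : ∀ i, Y i →L[ℂ] Y i) : Prop :=
  ∀ (y : ∀ i, Y i) (x : X), DConv l P y x → DConv l P (fun i => G i (y i)) x

/-- The difference quotients `(G i - 1) / h i` converge discretely at `x`, with limit `z`. -/
def ConsistentAt (l : Filter ι) (P : ∀ i, X →L[ℂ] Y i) (h : ι → ℝ) (G : ∀ i, Y i →L[ℂ] Y i)
    (x z : X) : Prop :=
  DConv l P (fun i => (h i : ℂ)⁻¹ • (G i (P i x) - P i x)) z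

variable {l : Filter ι} {P : ∀ i, X →L[ℂ] Y i}

theorem DConv.congr' {y y' : ∀ i, Y i} {x : X} (hy : DConv l P y x)
    (e : ∀ᶠ i in l, y i = y' i) : DConv l P y' x := by
  refine Tendsto.congr' ?_ hy
  filter_upwards [e] with i hi
  rw [hi]

theorem DConv.add {y y' : ∀ i, Y i} {x x' : X} (hy : DConv l P y x) (hy' : DConv l P y' x') :
    DConv l P (fun i => y i + y' i) (x + x') := by
  refine squeeze_zero (fun _ => norm_nonneg _) (fun i => ?_) (by simpa using Tendsto.add hy hy')
  rw [map_add, add_sub_add_comm]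
  exact norm_add_le _ _

theorem DConv.smul {y : ∀ i, Y i} {x : X} (c : ℂ) (hy : DConv l P y x) :
    DConv l P (fun i => c • y i) (c • x) := by
  have := Tendsto.const_mul ‖c‖ hy
  rw [mul_zero] at this
  refine this.congr fun i => ?_
  rw [map_smul, ← smul_sub, norm_smul]

theorem DConv.zero : DConv l P (fun _ => 0) 0 := by
  simpa [DConv] using tendsto_const_nhds

theorem DConv.sum {α : Type*} (s : Finset α) {y : α → ∀ i, Y i} {x : α → X}
    (hy : ∀ a ∈ s, DConv l P (y a) (x a)) :
    DConv l P (fun i => ∑ a ∈ s, y a i) (∑ a ∈ s, x a) := by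
  classical
  induction s using Finset.induction_on with
  | empty => simpa using DConv.zero
  | insert a s ha ih =>
    simp only [Finset.sum_insert ha]
    exact (hy a (Finset.mem_insert_self _ _)).add
      (ih fun b hb => hy b (Finset.mem_insert_of_mem hb))

theorem TendstoId.one : TendstoId l P (fun _ => 1) := fun _ _ hy => hy

theorem TendstoId.mul {G H : ∀ i, Y i →L[ℂ] Y i} (hG : TendstoId l P G) (hH : TendstoId l P H) :
    TendstoId l P (fun i => G i * H i) := fun y x hy => hG _ _ (hH y x hy)

theorem TendstoId.pow {G : ∀ i, Y i →L[ℂ] Y i} (hG : TendstoId l P G) (j : ℕ) :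
    TendstoId l P (fun i => G i ^ j) := by
  induction j with
  | zero => simpa using TendstoId.one
  | succ j ih => simpa only [pow_succ] using ih.mul hG

/-- Uniformly bounded operators that converge to the identity on a dense set do so everywhere. -/
theorem TendstoId.of_dense {K C : ℝ} (hP : ∀ i, ‖P i‖ ≤ K) {G : ∀ i, Y i →L[ℂ] Y i}
    (hG : ∀ᶠ i in l, ‖G i‖ ≤ C) {D : Set X} (hD : Dense D)
    (h : ∀ x ∈ D, DConv l P (fun i => G i (P i x)) x) : TendstoId l P G := by
  intro y x hy
  have h1 : Tendsto (fun i => ‖((G i).comp (P i) - P i) x‖) l (𝓝 0) := by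
    refine tendsto_norm_zero_of_mem_closure (C := C * K + K) ?_ h (hD x)
    filter_upwards [hG] with i hi
    refine (norm_sub_le _ _).trans (add_le_add ((ContinuousLinearMap.opNorm_comp_le _ _).trans ?_)
      (hP i))
    exact mul_le_mul hi (hP i) (norm_nonneg _) ((norm_nonneg _).trans hi)
  have h2 := (Tendsto.const_mul C hy).add h1
  rw [mul_zero, zero_add] at h2
  refine squeeze_zero' (Eventually.of_forall fun _ => norm_nonneg _) ?_ h2
  filter_upwards [hG] with i hi
  have e : G i (y i) - P i x = G i (y i - P i x) + ((G i).comp (P i) - P i) x := by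
    simp
  rw [e]
  exact (norm_add_le _ _).trans (add_le_add_left ((G i).le_of_opNorm_le hi _) _)

theorem ConsistentAt.one {h : ι → ℝ} (x : X) : ConsistentAt l P h (fun _ => 1) x 0 := by
  simpa [ConsistentAt] using DConv.zero

/-- Product rule from `GH - 1 = (G - 1) + G (H - 1)`. The last term applies `G` to a discretely
convergent family, which is why `TendstoId` quantifies over all such families. -/
theorem ConsistentAt.mul {h : ι → ℝ} {G H : ∀ i, Y i →L[ℂ] Y i} {x z w : X}
    (hGI : TendstoId l P G) (hG : ConsistentAt l P h G x z) (hH : ConsistentAt l P h H x w) :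
    ConsistentAt l P h (fun i => G i * H i) x (z + w) := by
  refine (hG.add (hGI _ _ hH)).congr' (Eventually.of_forall fun i => ?_)
  simp only [map_smul, map_sub, mul_apply_eq_comp, ← smul_add]
  congr 1
  abel

theorem ConsistentAt.pow {h : ι → ℝ} {G : ∀ i, Y i →L[ℂ] Y i} {x z : X}
    (hGI : TendstoId l P G) (hG : ConsistentAt l P h G x z) (j : ℕ) :
    ConsistentAt l P h (fun i => G i ^ j) x ((j : ℂ) • z) := by
  induction j with
  | zero => simpa using ConsistentAt.one x
  | succ j ih =>
    have := ConsistentAt.mul (hGI.pow j) ih hG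
    simp only [pow_succ, Nat.cast_succ, add_smul, one_smul]
    exact this

/-- Used for the half steps of the Strang splitting: relative to the full step `h`, the operator
`r((h/2) A)` contributes only `A / 2`. -/
theorem ConsistentAt.congr_step {h h' : ι → ℝ} {G : ∀ i, Y i →L[ℂ] Y i} {x z : X} (c : ℝ)
    (hG : ConsistentAt l P h G x z) (hh : ∀ i, h i = c * h' i) (hc : c ≠ 0) :
    ConsistentAt l P h' G x ((c : ℂ) • z) := by
  refine (hG.smul (c : ℂ)).congr' (Eventually.of_forall fun i => ?_)
  rw [smul_smul, hh i]
  congr 1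
  push_cast
  rw [mul_inv, mul_inv_cancel_left₀ (by exact_mod_cast hc)]

/-- Weighted means of consistent operators are consistent. -/
theorem ConsistentAt.weighted {h : ι → ℝ} {G H : ∀ i, Y i →L[ℂ] Y i} {x z : X} {a b : ℂ}
    (hab : a + b = 1) (hG : ConsistentAt l P h G x z) (hH : ConsistentAt l P h H x z) :
    ConsistentAt l P h (fun i => a • G i + b • H i) x z := by
  have := (hG.smul a).add (hH.smul b)
  rw [← add_smul, hab, one_smul] at this
  refine this.congr' (Eventually.of_forall fun i => ?_)
  have e : P i x = a • P i x + b • P i x := by rw [← add_smul, hab, one_smul]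
  simp only [add_apply, smul_apply]
  rw [smul_comm a, smul_comm b, ← smul_add]
  congr 1
  simp only [smul_sub]
  rw [sub_add_sub_comm, ← e]

end DiscreteConvergence

/-! ### Uniform bounds for the resolvent factors. -/

section Resolvents

variable {E : Type*} [NormedAddCommGroup E] [NormedSpace ℂ E]

/-- `(I - s A)⁻¹ x - x = s (I - s A)⁻¹ A x` on `D(A)`. -/
theorem invOneSub_apply_sub {A : E →ₗ.[ℂ] E} {s : ℂ} (hs : s ≠ 0) (h : s⁻¹ ∈ rho A)
    (x : A.domain) : invOneSub A s x - x = s • invOneSub A s (A x) := by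
  have e := (isResolventAt_res h).1 x
  rw [map_sub, map_smul] at e
  rw [invOneSub, if_neg hs, smul_apply, smul_apply,
    smul_smul, mul_inv_cancel₀ hs, one_smul, sub_eq_iff_eq_add, ← sub_eq_iff_eq_add', e]

theorem norm_invOneSub_le {A : E →ₗ.[ℂ] E} {M : ℝ} (hA : ResolventBound A M) {s : ℂ}
    (hs : 0 < (s⁻¹).re) : ‖invOneSub A s‖ ≤ ‖s⁻¹‖ / (s⁻¹).re * M := by
  have hs0 : s ≠ 0 := by rintro rfl; simp at hs
  have h := (hA _ hs).2
  rw [norm_smul, Complex.norm_real, Real.norm_of_nonneg hs.le] at h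
  rw [invOneSub, if_neg hs0, norm_smul, div_mul_eq_mul_div, mul_div_assoc]
  refine mul_le_mul_of_nonneg_left ?_ (norm_nonneg _)
  rw [le_div_iff₀ hs, mul_comm]
  exact h

theorem inv_ofReal_div {h : ℝ} (p : ℂ) : ((h : ℂ) / p)⁻¹ = ((h⁻¹ : ℝ) : ℂ) * p := by
  rw [inv_div, Complex.ofReal_inv, div_eq_inv_mul]

theorem re_inv_ofReal_div_pos {h : ℝ} (hh : 0 < h) {p : ℂ} (hp : 0 < p.re) :
    0 < (((h : ℂ) / p)⁻¹).re := by
  rw [inv_ofReal_div, Complex.re_ofReal_mul]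
  positivity

/-- The point `p / h` runs along a ray in the right half-plane, where `|μ| / Re μ` is constant;
hence the bound does not depend on `h`. -/
theorem norm_invOneSub_div_le {A : E →ₗ.[ℂ] E} {M : ℝ} (hA : ResolventBound A M) {h : ℝ}
    (hh : 0 < h) {p : ℂ} (hp : 0 < p.re) : ‖invOneSub A (h / p)‖ ≤ ‖p‖ / p.re * M := by
  refine (norm_invOneSub_le hA (re_inv_ofReal_div_pos hh hp)).trans_eq ?_
  rw [inv_ofReal_div, Complex.re_ofReal_mul, norm_mul, Complex.norm_real,
    Real.norm_of_nonneg (inv_pos.2 hh).le, mul_div_mul_left _ _ (inv_pos.2 hh).ne']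

end Resolvents

/-! ### Consistency of rational functions of the approximating operators. -/

section RationalApproximation

variable {ι : Type*} {X : Type*} [NormedAddCommGroup X] [NormedSpace ℂ X]
  {Y : ι → Type*} [∀ i, NormedAddCommGroup (Y i)] [∀ i, NormedSpace ℂ (Y i)]
  {l : Filter ι} {P : ∀ i, X →L[ℂ] Y i} {K M : ℝ} {A : X →ₗ.[ℂ] X} {A' : ∀ i, Y i →ₗ.[ℂ] Y i}
  {h : ι → ℝ} {p : ℂ}

/-- On `D(A)` the deviation from the identity is `s (I - s A')⁻¹ A' P x` with `s = h / p → 0`, and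
`A' P x` stays bounded because it converges discretely. Uniform boundedness extends this to all of
`X`. -/
theorem tendstoId_invOneSub (hP : ∀ i, ‖P i‖ ≤ K) (hA : Dense (A.domain : Set X))
    (hA' : ∀ i, ResolventBound (A' i) M) (hPA : ∀ i, ∀ x ∈ A.domain, P i x ∈ (A' i).domain)
    (hcons : ∀ x : A.domain, DConv l P (fun i => A' i ⟨P i x, hPA i x x.2⟩) (A x))
    (hpos : ∀ᶠ i in l, 0 < h i) (hlim : Tendsto h l (𝓝 0)) (hp : 0 < p.re) :
    TendstoId l P (fun i => invOneSub (A' i) (h i / p)) := by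
  have hp0 : p ≠ 0 := by rintro rfl; simp at hp
  refine TendstoId.of_dense (C := ‖p‖ / p.re * M) hP ?_ hA fun x hx => ?_
  · filter_upwards [hpos] with i hi using norm_invOneSub_div_le (hA' i) hi hp
  · have hb : Tendsto (fun i => ‖(h i / p : ℂ)‖ * ((‖p‖ / p.re * M) *
        (‖A' i ⟨P i x, hPA i x hx⟩ - P i (A ⟨x, hx⟩)‖ + K * ‖A ⟨x, hx⟩‖))) l (𝓝 0) := by
      have h1 : Tendsto (fun i => ‖(h i / p : ℂ)‖) l (𝓝 0) := by
        have := ((Complex.continuous_ofReal.tendsto 0).comp hlim).div_const p |>.norm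
        simpa using this
      have h2 := ((hcons ⟨x, hx⟩).add_const (K * ‖A ⟨x, hx⟩‖)).const_mul (‖p‖ / p.re * M)
      simpa using h1.mul h2
    refine squeeze_zero' (Eventually.of_forall fun _ => norm_nonneg _) ?_ hb
    filter_upwards [hpos] with i hi
    have hs : (h i / p : ℂ) ≠ 0 := div_ne_zero (by exact_mod_cast hi.ne') hp0
    have e := invOneSub_apply_sub hs (hA' i _ (re_inv_ofReal_div_pos hi hp)).1
      ⟨P i x, hPA i x hx⟩
    rw [e, norm_smul]
    refine mul_le_mul_of_nonneg_left (((invOneSub (A' i) _).le_of_opNorm_le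
      (norm_invOneSub_div_le (hA' i) hi hp) _).trans ?_) (norm_nonneg _)
    refine mul_le_mul_of_nonneg_left ?_
      ((norm_nonneg _).trans (norm_invOneSub_div_le (hA' i) hi hp))
    have h3 := norm_add_le (A' i ⟨P i x, hPA i x hx⟩ - P i (A ⟨x, hx⟩)) (P i (A ⟨x, hx⟩))
    rw [sub_add_cancel] at h3
    exact h3.trans (add_le_add_right ((P i).le_of_opNorm_le (hP i) _) _)

/-- The difference quotient equals `p⁻¹ (I - (h/p) A')⁻¹ A' P x`: an operator tending to the
identity, applied to a family converging to `A x`. -/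
theorem consistentAt_invOneSub (hP : ∀ i, ‖P i‖ ≤ K) (hA : Dense (A.domain : Set X))
    (hA' : ∀ i, ResolventBound (A' i) M) (hPA : ∀ i, ∀ x ∈ A.domain, P i x ∈ (A' i).domain)
    (hcons : ∀ x : A.domain, DConv l P (fun i => A' i ⟨P i x, hPA i x x.2⟩) (A x))
    (hpos : ∀ᶠ i in l, 0 < h i) (hlim : Tendsto h l (𝓝 0)) (hp : 0 < p.re) (x : A.domain) :
    ConsistentAt l P h (fun i => invOneSub (A' i) (h i / p)) x (p⁻¹ • A x) := by
  have hp0 : p ≠ 0 := by rintro rfl; simp at hp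
  refine ((tendstoId_invOneSub hP hA hA' hPA hcons hpos hlim hp _ _ (hcons x)).smul p⁻¹).congr' ?_
  filter_upwards [hpos] with i hi
  have hi0 : (h i : ℂ) ≠ 0 := by exact_mod_cast hi.ne'
  have e := invOneSub_apply_sub (div_ne_zero hi0 hp0) (hA' i _ (re_inv_ofReal_div_pos hi hp)).1
    ⟨P i x, hPA i x x.2⟩
  rw [e, smul_smul, div_eq_mul_inv, inv_mul_cancel_left₀ hi0]

/-- The value and the derivative at zero of a partial fraction decomposition. -/
theorem IsPartialFraction.sums {r : RatFunc ℂ} (hr : ApproximatesExp r)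
    (h0 : r.denom.eval 0 ≠ 0) {c₀ : ℂ} {c : ℂ → ℕ → ℂ} (hc : IsPartialFraction r c₀ c) :
    (c₀ + ∑ p ∈ r.denom.roots.toFinset,
      ∑ j ∈ Finset.range (r.denom.rootMultiplicity p), c p j = 1) ∧
    (∑ p ∈ r.denom.roots.toFinset, ∑ j ∈ Finset.range (r.denom.rootMultiplicity p),
      c p j * (((j + 1 : ℕ) : ℂ) * p⁻¹) = 1) := by
  constructor
  · have := hc 0 h0
    rw [hr.1] at this
    simpa using this.symm
  · have hd : HasDerivAt (fun z : ℂ => c₀ + ∑ p ∈ r.denom.roots.toFinset,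
        ∑ j ∈ Finset.range (r.denom.rootMultiplicity p), c p j * ((1 - z / p)⁻¹) ^ (j + 1))
        (∑ p ∈ r.denom.roots.toFinset, ∑ j ∈ Finset.range (r.denom.rootMultiplicity p),
          c p j * (((j + 1 : ℕ) : ℂ) * p⁻¹)) 0 := by
      refine HasDerivAt.const_add _ (HasDerivAt.fun_sum fun p _ => HasDerivAt.fun_sum fun j _ => ?_)
      refine HasDerivAt.const_mul _ ?_
      have h1 : HasDerivAt (fun z : ℂ => 1 - z / p) (-(1 / p)) 0 :=
        ((hasDerivAt_id (0 : ℂ)).div_const p).const_sub 1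
      have h2 := (h1.fun_inv (by simp)).fun_pow (j + 1)
      simpa using h2
    have hev : value r =ᶠ[𝓝 0] fun z : ℂ => c₀ + ∑ p ∈ r.denom.roots.toFinset,
        ∑ j ∈ Finset.range (r.denom.rootMultiplicity p), c p j * ((1 - z / p)⁻¹) ^ (j + 1) := by
      filter_upwards [r.denom.continuous.continuousAt.eventually_ne h0] with z hz using hc z hz
    exact (hd.congr_of_eventuallyEq hev).unique hr.2

theorem re_pos_of_mem_roots {r : RatFunc ℂ} (hr : BoundedOnLeftHalfPlane r)
    (hp : p ∈ r.denom.roots.toFinset) : 0 < p.re := by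
  obtain ⟨C, hC⟩ := hr
  by_contra hn
  exact (hC p (not_lt.1 hn)).1 (Polynomial.mem_roots'.1 (Multiset.mem_toFinset.1 hp)).2

theorem BoundedOnLeftHalfPlane.denom_eval_zero {r : RatFunc ℂ} (hr : BoundedOnLeftHalfPlane r) :
    r.denom.eval 0 ≠ 0 := by
  obtain ⟨C, hC⟩ := hr
  exact (hC 0 (by simp)).1

/-- At step zero every resolvent factor is the identity, so only the coefficient sum `r(0) = 1`
survives. -/
theorem ratOp_zero {E : Type*} [NormedAddCommGroup E] [NormedSpace ℂ E] {r : RatFunc ℂ}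
    (hr : ApproximatesExp r) (hb : BoundedOnLeftHalfPlane r) (A : E →ₗ.[ℂ] E) :
    ratOp r 0 A = 1 := by
  obtain ⟨c₀, c, hc⟩ := exists_isPartialFraction hb
  rw [ratOp_eq hb.denom_eval_zero hc, partialFractionOp]
  simp only [invOneSub, Complex.ofReal_zero, zero_div, if_true, one_pow, ← Finset.sum_smul,
    ← add_smul]
  rw [(hc.sums hr hb.denom_eval_zero).1, one_smul]

theorem tendstoId_ratOp {r : RatFunc ℂ} (hr : ApproximatesExp r) (hb : BoundedOnLeftHalfPlane r)
    (hP : ∀ i, ‖P i‖ ≤ K) (hA : Dense (A.domain : Set X))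
    (hA' : ∀ i, ResolventBound (A' i) M) (hPA : ∀ i, ∀ x ∈ A.domain, P i x ∈ (A' i).domain)
    (hcons : ∀ x : A.domain, DConv l P (fun i => A' i ⟨P i x, hPA i x x.2⟩) (A x))
    (hpos : ∀ᶠ i in l, 0 < h i) (hlim : Tendsto h l (𝓝 0)) :
    TendstoId l P (fun i => ratOp r (h i) (A' i)) := by
  obtain ⟨c₀, c, hc⟩ := exists_isPartialFraction hb
  intro y x hy
  have h1 := (hy.smul c₀).add (DConv.sum r.denom.roots.toFinset fun p hp =>
    DConv.sum (Finset.range (r.denom.rootMultiplicity p)) fun j _ =>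
      ((tendstoId_invOneSub hP hA hA' hPA hcons hpos hlim
        (re_pos_of_mem_roots hb hp)).pow (j + 1) y x hy).smul (c p j))
  simp only [← Finset.sum_smul, ← add_smul] at h1
  rw [(hc.sums hr hb.denom_eval_zero).1, one_smul] at h1
  refine h1.congr' (Eventually.of_forall fun i => ?_)
  simp [ratOp_eq hb.denom_eval_zero hc, partialFractionOp]

/-- The `j`-th power of the factor at the pole `p` contributes `(j / p) A x`; weighted by the
coefficients, these add up to `r'(0) A x = A x`. -/
theorem consistentAt_ratOp {r : RatFunc ℂ} (hr : ApproximatesExp r)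
    (hb : BoundedOnLeftHalfPlane r) (hP : ∀ i, ‖P i‖ ≤ K) (hA : Dense (A.domain : Set X))
    (hA' : ∀ i, ResolventBound (A' i) M) (hPA : ∀ i, ∀ x ∈ A.domain, P i x ∈ (A' i).domain)
    (hcons : ∀ x : A.domain, DConv l P (fun i => A' i ⟨P i x, hPA i x x.2⟩) (A x))
    (hpos : ∀ᶠ i in l, 0 < h i) (hlim : Tendsto h l (𝓝 0)) (x : A.domain) :
    ConsistentAt l P h (fun i => ratOp r (h i) (A' i)) x (A x) := by
  obtain ⟨c₀, c, hc⟩ := exists_isPartialFraction hb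
  have hs := hc.sums hr hb.denom_eval_zero
  have h1 := DConv.sum r.denom.roots.toFinset fun p hp =>
    DConv.sum (Finset.range (r.denom.rootMultiplicity p)) fun j _ =>
      DConv.smul (c p j) (ConsistentAt.pow
        (tendstoId_invOneSub hP hA hA' hPA hcons hpos hlim (re_pos_of_mem_roots hb hp))
        (consistentAt_invOneSub hP hA hA' hPA hcons hpos hlim (re_pos_of_mem_roots hb hp) x)
        (j + 1))
  simp only [smul_smul, ← Finset.sum_smul] at h1
  rw [hs.2, one_smul] at h1
  refine h1.congr' (Eventually.of_forall fun i => ?_)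
  -- Distributing `P i x` according to `r(0) = 1` cancels the constant term and pairs every power
  -- with its own `-1`.
  have e : P i x = c₀ • P i x + ∑ p ∈ r.denom.roots.toFinset,
      ∑ j ∈ Finset.range (r.denom.rootMultiplicity p), c p j • P i x := by
    simp only [← Finset.sum_smul, ← add_smul]
    rw [hs.1, one_smul]
  simp only [mul_comm (c _ _) (_⁻¹), mul_smul, ← Finset.smul_sum]
  congr 1
  conv_rhs => rw [ratOp_eq hb.denom_eval_zero hc, partialFractionOp]; arg 2; rw [e]
  simp [smul_sub, Finset.sum_sub_distrib]

end RationalApproximation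

end Splitting

namespace Splitting

/-! ### Strongly continuous semigroups and their generators. -/

section Semigroups

variable {X : Type*} [NormedAddCommGroup X] [NormedSpace ℂ X] {U : ℝ → X →L[ℂ] X}
  {C : X →ₗ.[ℂ] X}

theorem IsC0Semigroup.commute (hU : IsC0Semigroup U) {s t : ℝ} (hs : 0 ≤ s) (ht : 0 ≤ t) (x : X) :
    U s (U t x) = U t (U s x) := by
  have h1 := hU.map_add s t hs ht
  rw [add_comm, hU.map_add t s ht hs] at h1
  exact (congrArg (fun L : X →L[ℂ] X => L x) h1).symm

theorem IsC0Semigroup.exists_norm_le [CompleteSpace X] (hU : IsC0Semigroup U) (t : ℝ) :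
    ∃ N : ℝ, ∀ s ∈ Set.Icc 0 t, ‖U s‖ ≤ N := by
  obtain ⟨N, hN⟩ := banach_steinhaus (g := fun s : Set.Icc 0 t => U s) fun x => by
    obtain ⟨b, hb⟩ := isCompact_Icc.exists_bound_of_continuousOn
      ((hU.continuousOn x).mono (Set.Icc_subset_Ici_self : Set.Icc 0 t ⊆ _))
    exact ⟨b, fun s => hb s s.2⟩
  exact ⟨N, fun s hs => hN ⟨s, hs⟩⟩

/-- The semigroup leaves the graph of its generator invariant. -/
theorem IsGenerator.map_mem_graph (hU : IsC0Semigroup U) (hC : IsGenerator C U) {x y : X}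
    (h : (x, y) ∈ C.graph) {s : ℝ} (hs : 0 ≤ s) : (U s x, U s y) ∈ C.graph := by
  rw [hC] at h ⊢
  refine Tendsto.congr' ?_ (((U s).continuous.tendsto y).comp h)
  filter_upwards [self_mem_nhdsWithin] with k hk
  simp only [Function.comp_apply, map_smul, map_sub]
  rw [hU.commute hs (le_of_lt hk)]

theorem IsC0Semigroup.intervalIntegrable (hU : IsC0Semigroup U) (x : X) {b c : ℝ} (hb : 0 ≤ b)
    (hc : 0 ≤ c) : IntervalIntegrable (fun s => U s x) MeasureTheory.volume b c :=
  ((hU.continuousOn x).mono fun _ hs => (le_min hb hc).trans hs.1).intervalIntegrable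

/-- This is the right derivative of the integral of a continuous orbit. -/
theorem IsC0Semigroup.tendsto_mean [CompleteSpace X] (hU : IsC0Semigroup U) (x : X) {b : ℝ}
    (hb : 0 ≤ b) : Tendsto (fun k : ℝ => (k : ℂ)⁻¹ • ∫ s in b..(b + k), U s x)
      (𝓝[>] 0) (𝓝 (U b x)) := by
  have hsub : Set.Ioi b ⊆ Set.Ici 0 := fun s hs => hb.trans (le_of_lt hs)
  have h1 := intervalIntegral.integral_hasDerivWithinAt_right (s := Set.Ici b) (t := Set.Ioi b)
    (hU.intervalIntegrable x hb hb)
    (((hU.continuousOn x).mono hsub).stronglyMeasurableAtFilter_nhdsWithin measurableSet_Ioi b)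
    (((hU.continuousOn x) b hb).mono hsub)
  have h2 := (hasDerivWithinAt_iff_tendsto_slope' (Set.self_notMem_Ioi)).1 h1.Ioi_of_Ici
  have h3 : Tendsto (fun k : ℝ => b + k) (𝓝[>] 0) (𝓝[>] b) := by
    refine tendsto_nhdsWithin_iff.2 ⟨?_, ?_⟩
    · exact ((continuous_const.add continuous_id).tendsto' 0 b (by simp)).mono_left
        nhdsWithin_le_nhds
    · filter_upwards [self_mem_nhdsWithin] with k hk using lt_add_of_pos_right b hk
  refine (h2.comp h3).congr fun k => ?_
  rw [Function.comp_apply, slope_def_module, intervalIntegral.integral_same, sub_zero,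
    add_sub_cancel_left, ← Complex.ofReal_inv, Complex.coe_smul]

/-- Orbit averages lie in the domain of the generator. -/
theorem IsGenerator.integral_mem_graph [CompleteSpace X] (hU : IsC0Semigroup U)
    (hC : IsGenerator C U) (x : X) {a : ℝ} (ha : 0 ≤ a) :
    (∫ s in 0..a, U s x, U a x - x) ∈ C.graph := by
  rw [hC]
  have hint : ∀ {b c : ℝ}, 0 ≤ b → 0 ≤ c → IntervalIntegrable (fun s => U s x)
      MeasureTheory.volume b c := fun hb hc => hU.intervalIntegrable x hb hc
  have h1 := (hU.tendsto_mean x ha).sub (hU.tendsto_mean x le_rfl)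
  rw [hU.map_zero] at h1
  refine Tendsto.congr' ?_ h1
  filter_upwards [self_mem_nhdsWithin] with k hk
  have hk' : 0 ≤ k := le_of_lt hk
  simp only [zero_add]
  rw [← smul_sub]
  congr 1
  rw [← (U k).intervalIntegral_comp_comm (hint le_rfl ha)]
  -- `U k` shifts the window of integration, so the increment is the mean over `[a, a + k]` minus
  -- the mean over `[0, k]`.
  have e : ∫ s in 0..a, U k (U s x) = ∫ s in (0 + k)..(a + k), U s x := by
    rw [← intervalIntegral.integral_comp_add_right (fun s => U s x)]
    refine intervalIntegral.integral_congr fun s hs => ?_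
    rw [Set.uIcc_of_le ha] at hs
    rw [add_comm, hU.map_add k s hk' hs.1]
    rfl
  rw [e, zero_add, intervalIntegral.integral_interval_sub_interval_comm'
    (hint hk' (by positivity)) (hint le_rfl ha) (hint hk' le_rfl)]

/-- The domain of the square of a generator is dense. -/
theorem IsGenerator.dense_domain_sq [CompleteSpace X] (hU : IsC0Semigroup U)
    (hC : IsGenerator C U) :
    Dense {x : X | ∃ y z : X, (x, y) ∈ C.graph ∧ (y, z) ∈ C.graph} := by
  have hmean : ∀ x : X, Tendsto (fun k : ℝ => (k : ℂ)⁻¹ • ∫ s in 0..k, U s x)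
      (𝓝[>] 0) (𝓝 x) := fun x => by
    simpa [hU.map_zero] using hU.tendsto_mean x le_rfl
  have hsmul : ∀ (c : ℂ) {x y : X}, (x, y) ∈ C.graph → (c • x, c • y) ∈ C.graph :=
    fun c x y h => C.graph.smul_mem c h
  have h1 : Dense {x : X | ∃ y : X, (x, y) ∈ C.graph} := fun x =>
    mem_closure_of_tendsto (hmean x) (by
      filter_upwards [self_mem_nhdsWithin] with k hk
      exact ⟨_, hsmul _ (hC.integral_mem_graph hU x (le_of_lt hk))⟩)
  refine fun x => closure_minimal ?_ isClosed_closure (h1 x)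
  rintro x ⟨y, hxy⟩
  refine mem_closure_of_tendsto (hmean x) ?_
  filter_upwards [self_mem_nhdsWithin] with k hk
  -- The generator sends the orbit mean to `k⁻¹ (U k x - x)`, which lies in the domain again because
  -- `x` does.
  exact ⟨_, _, hsmul _ (hC.integral_mem_graph hU x (le_of_lt hk)),
    hsmul _ (C.graph.sub_mem (hC.map_mem_graph hU hxy (le_of_lt hk)) hxy)⟩

end Semigroups

/-! ### Chernoff's product formula on varying spaces. -/

section Chernoff

/-- The resolvent of `(V - 1) / h` at `2 ω + 1` for a power-bounded `V`. -/
theorem exists_resolvent_of_norm_pow_le {E : Type*} [NormedAddCommGroup E] [NormedSpace ℂ E]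
    [CompleteSpace E] {V : E →L[ℂ] E} {h M ω : ℝ} (hh : 0 < h) (hω : 0 ≤ ω) (hhω : h * ω ≤ 1)
    (hV : ∀ k : ℕ, ‖V ^ k‖ ≤ M * Real.exp (k * h * ω)) :
    ∃ R : E →L[ℂ] E, ‖R‖ ≤ M ∧ ∀ y : E,
      R ((2 * ω + 1 : ℂ) • y - (h : ℂ)⁻¹ • (V y - y)) = y ∧
      V (R y) = R y + (h : ℂ) • ((2 * ω + 1 : ℂ) • R y - y) := by
  have hM : 0 ≤ M := by simpa using (norm_nonneg _).trans (hV 0)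
  -- Chosen so that `(2ω + 1) - (V - 1) / h = (μ / h) (1 - V / μ)`, which a Neumann series in `V /
  -- μ` inverts.
  set μ : ℝ := 1 + (2 * ω + 1) * h with hμ
  have hμ0 : 0 < μ := by positivity
  have hμc : (μ : ℂ) ≠ 0 := by exact_mod_cast hμ0.ne'
  have hhc : (h : ℂ) ≠ 0 := by exact_mod_cast hh.ne'
  set ρ : ℝ := (1 + 2 * (h * ω)) / μ with hρ
  have hρ0 : 0 ≤ ρ := by positivity
  have hρ1 : 1 - ρ = h / μ := by rw [hρ, hμ]; field_simp; ring
  -- Here `h ω ≤ 1` is needed. The factor `2` explains the point `2ω + 1`: it leaves `1 - ρ = h /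
  -- μ`, exactly what makes the resolvent bound `M`.
  have hexp : Real.exp (h * ω) ≤ 1 + 2 * (h * ω) := by
    have h0 : 0 ≤ h * ω := by positivity
    have := Real.abs_exp_sub_one_le (x := h * ω) (by rwa [abs_of_nonneg h0])
    rw [abs_of_nonneg h0] at this
    linarith [le_abs_self (Real.exp (h * ω) - 1)]
  set W : E →L[ℂ] E := (μ : ℂ)⁻¹ • V with hW
  have hWk : ∀ k : ℕ, ‖W ^ k‖ ≤ M * ρ ^ k := by
    intro k
    rw [hW, smul_pow, norm_smul, norm_pow, norm_inv, Complex.norm_real,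
      Real.norm_of_nonneg hμ0.le, hρ, div_pow, inv_pow, inv_mul_eq_div, ← mul_div_assoc]
    refine div_le_div_of_nonneg_right ((hV k).trans (mul_le_mul_of_nonneg_left ?_ hM))
      (by positivity)
    rw [mul_assoc, Real.exp_nat_mul]
    exact pow_le_pow_left₀ (Real.exp_pos _).le hexp k
  have hρlt : ρ < 1 := by have : 0 < h / μ := by positivity
                          linarith
  have hgeo : HasSum (fun k => M * ρ ^ k) (M * (1 - ρ)⁻¹) :=
    (hasSum_geometric_of_lt_one hρ0 hρlt).mul_left M
  have hsum : Summable (fun k => W ^ k) := Summable.of_norm_bounded hgeo.summable hWk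
  set S : E →L[ℂ] E := ∑' k, W ^ k with hS
  have hSn : ‖S‖ ≤ M * (1 - ρ)⁻¹ := tsum_of_norm_bounded hgeo hWk
  have hS1 : S * (1 - W) = 1 := hsum.tsum_pow_mul_one_sub
  have hS2 : (1 - W) * S = 1 := hsum.one_sub_mul_tsum_pow
  refine ⟨((h / μ : ℝ) : ℂ) • S, ?_, fun y => ⟨?_, ?_⟩⟩
  · rw [norm_smul, Complex.norm_real, Real.norm_of_nonneg (by positivity)]
    refine (mul_le_mul_of_nonneg_left hSn (by positivity)).trans_eq ?_
    rw [hρ1]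
    field_simp
  · have e := congrArg (fun L : E →L[ℂ] E => L y) hS1
    simp only [mul_apply_eq_comp, sub_apply, one_apply_eq_self] at e
    have e2 : (2 * ω + 1 : ℂ) • y - (h : ℂ)⁻¹ • (V y - y) = ((μ / h : ℝ) : ℂ) • (y - W y) := by
      simp only [hW, smul_apply, smul_sub, smul_smul]
      have e3 : ((μ / h : ℝ) : ℂ) * (μ : ℂ)⁻¹ = (h : ℂ)⁻¹ := by push_cast; field_simp
      have e4 : ((μ / h : ℝ) : ℂ) = (2 * ω + 1 : ℂ) + (h : ℂ)⁻¹ := by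
        rw [hμ]; push_cast; field_simp; ring
      rw [e3, e4]
      module
    rw [e2, smul_apply, map_smul, e, smul_smul, ← Complex.ofReal_mul]
    have : h / μ * (μ / h) = 1 := by field_simp
    rw [this, Complex.ofReal_one, one_smul]
  · have e := congrArg (fun L : E →L[ℂ] E => L y) hS2
    simp only [mul_apply_eq_comp, sub_apply, one_apply_eq_self] at e
    have e1 : V (S y) = (μ : ℂ) • (S y - y) := by
      have : W (S y) = S y - y := (sub_eq_of_eq_add (sub_eq_iff_eq_add'.1 e)).symm
      rw [← this, hW, smul_apply, smul_smul, mul_inv_cancel₀ hμc, one_smul]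
    simp only [smul_apply, map_smul]
    rw [e1]
    have e3 : ((h / μ : ℝ) : ℂ) * μ = h := by push_cast; field_simp
    have e4 : ((h / μ : ℝ) : ℂ) + (h : ℂ) * ((2 * ω + 1 : ℂ) * ((h / μ : ℝ) : ℂ)) = h := by
      have : (μ : ℂ) = 1 + (2 * ω + 1) * h := by rw [hμ]; push_cast; ring
      rw [this] at e3
      linear_combination e3
    rw [smul_smul, e3, smul_sub, smul_sub, smul_smul, smul_smul, add_sub, ← add_smul, mul_assoc,
      e4]

/-- Telescoping estimate for a perturbed iteration. -/
theorem norm_pow_sub_le {E : Type*} [NormedAddCommGroup E] [NormedSpace ℂ E] {V : E →L[ℂ] E}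
    {c δ : ℝ} (n : ℕ) (hV : ∀ k ≤ n, ‖V ^ k‖ ≤ c) (v : ℕ → E)
    (hv : ∀ k < n, ‖V (v k) - v (k + 1)‖ ≤ δ) : ‖(V ^ n) (v 0) - v n‖ ≤ n * (c * δ) := by
  induction n generalizing v with
  | zero => simp
  | succ n ih =>
    have h1 := ih (fun k hk => hV k (by omega)) (fun k => v (k + 1))
      (fun k hk => hv (k + 1) (by omega))
    have h2 : ‖(V ^ n) (V (v 0) - v 1)‖ ≤ c * δ := by
      refine ((V ^ n).le_of_opNorm_le (hV n (by omega)) _).trans ?_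
      exact mul_le_mul_of_nonneg_left (hv 0 (by omega))
        ((norm_nonneg _).trans (hV n (by omega)))
    have e : (V ^ (n + 1)) (v 0) - v (n + 1) =
        (V ^ n) (V (v 0) - v 1) + ((V ^ n) (v (0 + 1)) - v (n + 1)) := by
      rw [pow_succ, mul_apply_eq_comp, map_sub]
      simp
    rw [e, Nat.cast_succ]
    linarith [norm_add_le ((V ^ n) (V (v 0) - v 1)) ((V ^ n) (v (0 + 1)) - v (n + 1))]

variable {ι : Type*} {X : Type*} [NormedAddCommGroup X] [NormedSpace ℂ X] [CompleteSpace X]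
  {Y : ι → Type*} [∀ i, NormedAddCommGroup (Y i)] [∀ i, NormedSpace ℂ (Y i)]
  [∀ i, CompleteSpace (Y i)] {l : Filter ι} {P : ∀ i, X →L[ℂ] Y i}

/-- Chernoff's product formula for operators `V i` on spaces `Y i` approximating `X`: stability
and consistency on a core of the generator imply convergence. -/
theorem dConv_pow_of_consistentAt {K M ω t : ℝ} (hP : ∀ i, ‖P i‖ ≤ K) {C : X →ₗ.[ℂ] X}
    {U : ℝ → X →L[ℂ] X} (hU : IsC0Semigroup U) (hC : IsGenerator C U) {h : ι → ℝ}
    (hpos : ∀ᶠ i in l, 0 < h i) (hlim : Tendsto h l (𝓝 0)) {V : ∀ i, Y i →L[ℂ] Y i}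
    (hω : 0 ≤ ω) (hV : ∀ᶠ i in l, ∀ k : ℕ, ‖V i ^ k‖ ≤ M * Real.exp (k * h i * ω))
    {D : Set (X × X)} (hD : (C.graph : Set (X × X)) ⊆ closure D)
    (hcons : ∀ p ∈ D, ConsistentAt l P h V p.1 p.2) {n : ι → ℕ} (ht : 0 ≤ t)
    (hn : ∀ᶠ i in l, n i * h i = t) (x : X) :
    DConv l P (fun i => (V i ^ n i) (P i x)) (U t x) := by
  -- The signs of `M` and `K` are read off at some index, so the filter must be nontrivial.
  rcases l.eq_or_neBot with rfl | hl
  · exact tendsto_bot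
  have hM : 0 ≤ M := by
    obtain ⟨i, hi⟩ := hV.exists
    simpa using (norm_nonneg _).trans (hi 0)
  have hK : 0 ≤ K := by
    obtain ⟨i, hi⟩ := hV.exists
    exact (norm_nonneg _).trans (hP i)
  have hVn : ∀ᶠ i in l, ∀ k ≤ n i, ‖V i ^ k‖ ≤ M * Real.exp (t * ω) := by
    filter_upwards [hV, hn, hpos] with i hi hni hi0 k hk
    refine (hi k).trans (mul_le_mul_of_nonneg_left (Real.exp_le_exp.2 ?_) hM)
    rw [← hni]
    gcongr
  obtain ⟨N, hN⟩ := hU.exists_norm_le t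
  -- it suffices to treat the domain of the square of the generator
  have hred : Tendsto (fun i => ‖((V i ^ n i).comp (P i) - (P i).comp (U t)) x‖) l (𝓝 0) := by
    refine tendsto_norm_zero_of_mem_closure (C := M * Real.exp (t * ω) * K + K * ‖U t‖) ?_ ?_
      (hC.dense_domain_sq hU x)
    · filter_upwards [hVn] with i hi
      refine (norm_sub_le _ _).trans (add_le_add
        ((ContinuousLinearMap.opNorm_comp_le _ _).trans ?_)
        ((ContinuousLinearMap.opNorm_comp_le _ _).trans ?_))
      · exact mul_le_mul (hi _ le_rfl) (hP i) (norm_nonneg _) (by positivity)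
      · exact mul_le_mul_of_nonneg_right (hP i) (norm_nonneg _)
    clear x
    rintro x ⟨y, z, hxy, hyz⟩
    -- the approximating resolvents
    have hR : ∀ i, ∃ R : Y i →L[ℂ] Y i, (0 < h i ∧ h i * ω ≤ 1 ∧
        ∀ k : ℕ, ‖V i ^ k‖ ≤ M * Real.exp (k * h i * ω)) → ‖R‖ ≤ M ∧ ∀ y : Y i,
        R ((2 * ω + 1 : ℂ) • y - (h i : ℂ)⁻¹ • (V i y - y)) = y ∧
        V i (R y) = R y + (h i : ℂ) • ((2 * ω + 1 : ℂ) • R y - y) := by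
      intro i
      by_cases H : 0 < h i ∧ h i * ω ≤ 1 ∧ ∀ k : ℕ, ‖V i ^ k‖ ≤ M * Real.exp (k * h i * ω)
      · obtain ⟨R, hR⟩ := exists_resolvent_of_norm_pow_le H.1 hω H.2.1 H.2.2
        exact ⟨R, fun _ => hR⟩
      · exact ⟨0, fun H' => absurd H' H⟩
    choose R hR using hR
    have hsmall : ∀ᶠ i in l, h i * ω ≤ 1 := by
      have h1 := hlim.mul_const ω
      rw [zero_mul] at h1
      filter_upwards [h1.eventually_lt_const one_pos] with i hi using hi.le
    replace hR : ∀ᶠ i in l, ‖R i‖ ≤ M ∧ ∀ y : Y i,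
        R i ((2 * ω + 1 : ℂ) • y - (h i : ℂ)⁻¹ • (V i y - y)) = y ∧
        V i (R i y) = R i y + (h i : ℂ) • ((2 * ω + 1 : ℂ) • R i y - y) := by
      filter_upwards [hpos, hsmall, hV] with i h1 h2 h3 using hR i ⟨h1, h2, h3⟩
    set lam : ℂ := 2 * ω + 1 with hlam
    have hRP : ∀ᶠ i in l, ‖(R i).comp (P i)‖ ≤ M * K := by
      filter_upwards [hR] with i hi
      exact (ContinuousLinearMap.opNorm_comp_le _ _).trans
        (mul_le_mul hi.1 (hP i) (norm_nonneg _) hM)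
    -- consistency error of the resolvents
    let Q : ∀ i, X × X →L[ℂ] Y i := fun i =>
      (lam • (R i).comp (P i) - P i).coprod (-((R i).comp (P i)))
    have hQ_apply : ∀ i (a b : X), Q i (a, b) = R i (P i (lam • a - b)) - P i a := by
      intro i a b
      simp only [Q, ContinuousLinearMap.coprod_apply, sub_apply, smul_apply, neg_apply,
        ContinuousLinearMap.comp_apply, map_sub, map_smul]
      abel
    have hQ : ∀ᶠ i in l, ‖Q i‖ ≤ (‖lam‖ * (M * K) + K) + M * K := by
      filter_upwards [hRP] with i hi
      refine ContinuousLinearMap.opNorm_le_bound _ (by positivity) fun p => ?_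
      rw [add_mul]
      refine (norm_add_le _ _).trans (add_le_add ?_ ?_)
      · refine (ContinuousLinearMap.le_of_opNorm_le (lam • (R i).comp (P i) - P i)
          (c := ‖lam‖ * (M * K) + K) ?_ p.1).trans
          (mul_le_mul_of_nonneg_left (norm_fst_le p) (by positivity))
        refine (norm_sub_le _ _).trans (add_le_add ?_ (hP i))
        rw [norm_smul]
        exact mul_le_mul_of_nonneg_left hi (norm_nonneg _)
      · refine (ContinuousLinearMap.le_of_opNorm_le (-((R i).comp (P i))) (c := M * K) ?_ p.2).trans
          (mul_le_mul_of_nonneg_left (norm_snd_le p) (by positivity))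
        rwa [norm_neg]
    have hQ0 : ∀ p ∈ C.graph, Tendsto (fun i => ‖Q i p‖) l (𝓝 0) := by
      intro p hp
      refine tendsto_norm_zero_of_mem_closure hQ ?_ (hD hp)
      rintro ⟨a, b⟩ hab
      have h1 := Tendsto.const_mul M (hcons _ hab)
      rw [mul_zero] at h1
      refine squeeze_zero' (Eventually.of_forall fun _ => norm_nonneg _) ?_ h1
      filter_upwards [hR] with i hi
      -- Writing `P i a` as `R i` applied to `(λ - (V i - 1) / h i) P i a` turns the resolvent error
      -- into `R i` of the consistency defect.
      have e : Q i (a, b) = R i ((h i : ℂ)⁻¹ • (V i (P i a) - P i a) - P i b) := by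
        rw [hQ_apply]
        have e1 := (hi.2 (P i a)).1
        simp only [map_sub, map_smul] at e1 ⊢
        linear_combination (norm := module) e1
      rw [e]
      exact (R i).le_of_opNorm_le hi.1 _
    -- the orbit of the second vector
    set w : X := lam • x - y with hw
    set w' : X := lam • y - z with hw'
    have hww : (w, w') ∈ C.graph :=
      C.graph.sub_mem (C.graph.smul_mem lam hxy) hyz
    -- The pairs `(U s w, U s w')` stay in the graph and trace a compact set, so the resolvent error
    -- is small uniformly in `s`.
    have hunif : ∀ ε : ℝ, 0 < ε → ∀ᶠ i in l, ∀ s ∈ Set.Icc 0 t,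
        ‖R i (P i (lam • U s w - U s w')) - P i (U s w)‖ < ε := by
      intro ε hε
      have hcomp : IsCompact ((fun s => (U s w, U s w')) '' Set.Icc 0 t) := by
        refine isCompact_Icc.image_of_continuousOn (ContinuousOn.prodMk ?_ ?_)
        · exact (hU.continuousOn w).mono Set.Icc_subset_Ici_self
        · exact (hU.continuousOn w').mono Set.Icc_subset_Ici_self
      have := eventually_forall_norm_lt_of_isCompact hQ hcomp (by
        rintro _ ⟨s, hs, rfl⟩
        exact hQ0 _ (hC.map_mem_graph hU hww hs.1)) hε
      filter_upwards [this] with i hi s hs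
      rw [← hQ_apply]
      exact hi _ ⟨s, hs, rfl⟩
    have hstart := hQ0 _ hxy
    have hend := hQ0 _ (hC.map_mem_graph hU hxy ht)
    have hgen : Tendsto (fun i => ‖(h i : ℂ)⁻¹ • (U (h i) w - w) - w'‖) l (𝓝 0) := by
      have h1 := ((hC w w').1 hww).comp (tendsto_nhdsWithin_iff.2 ⟨hlim, hpos⟩)
      exact tendsto_iff_norm_sub_tendsto_zero.1 h1
    rw [Metric.tendsto_nhds]
    intro ε hε
    set c : ℝ := M * Real.exp (t * ω) with hc
    have hc0 : 0 ≤ c := by positivity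
    -- The three summands bound the initial error carried by `V i ^ n i`, the accumulated one-step
    -- defects and the final error.
    obtain ⟨η, hη, hηε⟩ : ∃ η : ℝ, 0 < η ∧
        c * η + t * (c * (η + M * K * (|N| * η))) + η < ε := by
      refine ⟨ε / 2 / (c + t * (c * (1 + M * K * |N|)) + 1), by positivity, ?_⟩
      have : 0 < c + t * (c * (1 + M * K * |N|)) + 1 := by positivity
      set d := c + t * (c * (1 + M * K * |N|)) + 1 with hd
      have e : c * (ε / 2 / d) + t * (c * ((ε / 2 / d) + M * K * (|N| * (ε / 2 / d)))) + ε / 2 / d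
          = d * (ε / 2 / d) := by rw [hd]; ring
      rw [e, mul_div_cancel₀ _ this.ne']
      linarith
    filter_upwards [hR, hRP, hpos, hn, hVn, hunif η hη, hstart.eventually_lt_const hη,
      hend.eventually_lt_const hη, hgen.eventually_lt_const hη]
      with i hi hRPi hi0 hni hVi hu hs he hg
    rw [dist_zero_right, norm_norm]
    rw [hQ_apply] at hs he
    have hic : (h i : ℂ) ≠ 0 := by exact_mod_cast hi0.ne'
    -- Comparing with `R i P i (λ - C)` of the exact orbit, rather than with `P i` of it, lets `V i`
    -- act through the resolvent identity.
    let v : ℕ → Y i := fun k => R i (P i (U (k * h i) w))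
    have hv : ∀ k < n i, ‖V i (v k) - v (k + 1)‖ ≤ h i * (η + M * K * (|N| * η)) := by
      intro k hk
      have hk0 : (0 : ℝ) ≤ k * h i := by positivity
      have hkt : (k : ℝ) * h i ∈ Set.Icc 0 t := by
        refine ⟨hk0, hni ▸ ?_⟩
        gcongr
      have hUk : U (((k + 1 : ℕ) : ℝ) * h i) w = U (k * h i) (U (h i) w) := by
        have : ((k + 1 : ℕ) : ℝ) * h i = k * h i + h i := by push_cast; ring
        rw [this, hU.map_add _ _ hk0 hi0.le]
        rfl
      -- Inserting `h i • R i (P i (U (k * h i) w'))` with both signs separates the resolvent error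
      -- from the error of the difference quotient of `U` at `w`.
      have e : V i (v k) - v (k + 1) = (h i : ℂ) •
          ((R i (P i (lam • U (k * h i) w - U (k * h i) w')) - P i (U (k * h i) w)) -
          (R i).comp (P i) (U (k * h i) ((h i : ℂ)⁻¹ • (U (h i) w - w) - w'))) := by
        simp only [v, hUk, (hi.2 _).2, ContinuousLinearMap.comp_apply, map_sub, map_smul, smul_sub,
          smul_smul, mul_inv_cancel₀ hic, one_smul]
        abel
      rw [e, norm_smul, Complex.norm_real, Real.norm_of_nonneg hi0.le]
      refine mul_le_mul_of_nonneg_left ((norm_sub_le _ _).trans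
        (add_le_add (hu _ hkt).le ?_)) hi0.le
      refine (ContinuousLinearMap.le_of_opNorm_le _ hRPi _).trans
        (mul_le_mul_of_nonneg_left ?_ (by positivity))
      refine (ContinuousLinearMap.le_of_opNorm_le _ ((hN _ hkt).trans (le_abs_self N)) _).trans ?_
      exact mul_le_mul_of_nonneg_left hg.le (abs_nonneg _)
    have hmain := norm_pow_sub_le (n i) hVi v hv
    have hmain' : (n i : ℝ) * (c * (h i * (η + M * K * (|N| * η)))) =
        t * (c * (η + M * K * (|N| * η))) := by rw [← hni]; ring
    rw [hmain'] at hmain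
    have hv0 : v 0 = R i (P i (lam • x - y)) := by
      simp only [v, Nat.cast_zero, zero_mul, hU.map_zero]
      rfl
    have hvn : v (n i) = R i (P i (lam • U t x - U t y)) := by
      simp only [v, hni, hw, map_sub, map_smul]
    have e : ((V i ^ n i).comp (P i) - (P i).comp (U t)) x =
        -(V i ^ n i) (v 0 - P i x) + ((V i ^ n i) (v 0) - v (n i)) + (v (n i) - P i (U t x)) := by
      simp only [sub_apply, ContinuousLinearMap.comp_apply, map_sub]
      abel
    have h1 : ‖-(V i ^ n i) (v 0 - P i x)‖ ≤ c * η := by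
      rw [norm_neg, hv0]
      exact ((V i ^ n i).le_of_opNorm_le (hVi _ le_rfl) _).trans
        (mul_le_mul_of_nonneg_left hs.le hc0)
    have h2 : ‖v (n i) - P i (U t x)‖ ≤ η := by rw [hvn]; exact he.le
    rw [e]
    linarith [norm_add₃_le (a := -(V i ^ n i) (v 0 - P i x)) (b := (V i ^ n i) (v 0) - v (n i))
      (c := v (n i) - P i (U t x))]
  exact hred

end Chernoff

end Splitting

namespace Splitting

/-! ### Passage between `X` and the spaces `Y m`, and the joint limit. -/

section FullDiscretization

variable {X : Type*} [NormedAddCommGroup X] [NormedSpace ℂ X]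
  {Y : ℕ → Type*} [∀ m, NormedAddCommGroup (Y m)] [∀ m, NormedSpace ℂ (Y m)]
  {P : ∀ m, X →L[ℂ] Y m} {J : ∀ m, Y m →L[ℂ] X} {K : ℝ}

/-- Since `P J = I`, the difference `y - P x` is `P (J y - x)`. -/
theorem dConv_of_tendsto (hPJ : ∀ m, (P m).comp (J m) = ContinuousLinearMap.id ℂ (Y m))
    (hPK : ∀ m, ‖P m‖ ≤ K) {y : ∀ m, Y m} {x : X} (h : Tendsto (fun m => J m (y m)) atTop (𝓝 x)) :
    DConv ((atTop : Filter ℕ) ×ˢ (atTop : Filter ℕ)) (fun i => P i.1) (fun i => y i.1) x := by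
  have h1 := ((tendsto_iff_norm_sub_tendsto_zero.1 h).const_mul K).comp
    (tendsto_fst (f := (atTop : Filter ℕ)) (g := (atTop : Filter ℕ)))
  rw [mul_zero] at h1
  refine squeeze_zero (fun _ => norm_nonneg _) (fun i => ?_) h1
  have e : y i.1 = P i.1 (J i.1 (y i.1)) := by
    rw [← ContinuousLinearMap.comp_apply, hPJ]
    rfl
  change ‖y i.1 - P i.1 x‖ ≤ K * ‖J i.1 (y i.1) - x‖
  nth_rewrite 1 [e]
  rw [← map_sub]
  exact (P i.1).le_of_opNorm_le (hPK _) _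

theorem DConv.tendsto (hJP : ∀ x : X, Tendsto (fun m => J m (P m x)) atTop (𝓝 x))
    (hJK : ∀ m, ‖J m‖ ≤ K) {y : ∀ i : ℕ × ℕ, Y i.1} {x : X}
    (h : DConv ((atTop : Filter ℕ) ×ˢ (atTop : Filter ℕ)) (fun i => P i.1) y x) :
    Tendsto (fun i : ℕ × ℕ => J i.1 (y i)) (atTop ×ˢ atTop) (𝓝 x) := by
  have h1 : Tendsto (fun i : ℕ × ℕ => J i.1 (y i - P i.1 x)) (atTop ×ˢ atTop) (𝓝 0) := by
    refine squeeze_zero_norm (fun i => (J i.1).le_of_opNorm_le (hJK _) _) ?_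
    simpa using Tendsto.const_mul K h
  have h2 := h1.add ((hJP x).comp (tendsto_fst (g := (atTop : Filter ℕ))))
  rw [zero_add] at h2
  refine h2.congr fun i => ?_
  simp

variable [CompleteSpace X] [∀ m, CompleteSpace (Y m)]

/-- Convergence of a stable and consistent one-step method `V`, discretized in space. -/
theorem tendsto_pow_of_consistentAt {A B : X →ₗ.[ℂ] X} {U : ℝ → X →L[ℂ] X}
    (hAB : (A + B).IsClosable) (hU : IsC0Semigroup U) (hABU : IsGenerator (A + B).closure U)
    (hJP : ∀ x : X, Tendsto (fun m => J m (P m x)) atTop (𝓝 x))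
    (hJK : ∀ m, ‖J m‖ ≤ K) (hPK : ∀ m, ‖P m‖ ≤ K) {V : ℝ → ∀ m, Y m →L[ℂ] Y m}
    (hV0 : ∀ m, V 0 m = 1)
    (hcons : ∀ h : ℕ × ℕ → ℝ, (∀ᶠ i in atTop ×ˢ atTop, 0 < h i) →
      Tendsto h (atTop ×ˢ atTop) (𝓝 0) → ∀ x (hxA : x ∈ A.domain) (hxB : x ∈ B.domain),
        ConsistentAt (atTop ×ˢ atTop) (fun i => P i.1) h (fun i => V (h i) i.1) x
          (A ⟨x, hxA⟩ + B ⟨x, hxB⟩))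
    (hstab : ∃ M ω : ℝ, ∀ h : ℝ, 0 ≤ h → ∀ k m : ℕ,
      ‖V h m ^ k‖ ≤ M * Real.exp (k * h * ω)) {t : ℝ} (ht : 0 ≤ t) (x : X) :
    Tendsto (fun i : ℕ × ℕ => J i.1 ((V (t / i.2) i.1 ^ i.2) (P i.1 x)))
      (atTop ×ˢ atTop) (𝓝 (U t x)) := by
  -- For `t = 0` all steps vanish, while consistency speaks only of positive steps.
  rcases ht.eq_or_lt with rfl | ht0
  · rw [hU.map_zero]
    refine ((hJP x).comp (tendsto_fst (g := (atTop : Filter ℕ)))).congr fun i => ?_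
    simp [hV0]
  · obtain ⟨M, ω, hM⟩ := hstab
    have hM0 : 0 ≤ M := by simpa using (norm_nonneg _).trans (hM 0 le_rfl 0 0)
    have hn : ∀ᶠ i : ℕ × ℕ in atTop ×ˢ atTop, 1 ≤ i.2 :=
      tendsto_snd.eventually (eventually_ge_atTop 1)
    have hpos : ∀ᶠ i : ℕ × ℕ in atTop ×ˢ atTop, 0 < t / i.2 := by
      filter_upwards [hn] with i hi
      have : (0 : ℝ) < i.2 := by exact_mod_cast hi
      positivity
    have hlim : Tendsto (fun i : ℕ × ℕ => t / (i.2 : ℝ)) (atTop ×ˢ atTop) (𝓝 0) :=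
      (tendsto_const_div_atTop_nhds_zero_nat t).comp tendsto_snd
    refine DConv.tendsto (P := P) hJP hJK ?_
    refine dConv_pow_of_consistentAt (Y := fun i : ℕ × ℕ => Y i.1) (P := fun i => P i.1)
      (V := fun i => V (t / i.2) i.1) (n := fun i => i.2) (M := M) (ω := |ω|)
      (D := ((A + B).graph : Set (X × X))) (fun i => hPK i.1) hU hABU hpos hlim
      (abs_nonneg ω) ?_ ?_ ?_ ht ?_ x
    · filter_upwards [hpos] with i hi k
      refine (hM _ hi.le k i.1).trans (mul_le_mul_of_nonneg_left (Real.exp_le_exp.2 ?_) hM0)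
      exact mul_le_mul_of_nonneg_left (le_abs_self ω) (by positivity)
    -- By closability the generator's graph is the closure of that of `A + B`, so `D(A) ∩ D(B)` is a
    -- core.
    · rw [← hAB.graph_closure_eq_closure_graph, Submodule.topologicalClosure_coe]
    · rintro ⟨a, b⟩ hab
      obtain ⟨⟨a', ha'⟩, rfl, rfl⟩ := (LinearPMap.mem_graph_iff _).1 hab
      exact hcons _ hpos hlim a' ha'.1 ha'.2
    · filter_upwards [hn] with i hi
      have : (i.2 : ℝ) ≠ 0 := by positivity
      exact mul_div_cancel₀ t this

end FullDiscretization

end Splitting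

/-! ### Strang and weighted splittings. -/

theorem mainTheorem2
    {X : Type*} [NormedAddCommGroup X] [NormedSpace ℂ X] [CompleteSpace X]
    {Y : ℕ → Type*} [∀ m, NormedAddCommGroup (Y m)] [∀ m, NormedSpace ℂ (Y m)]
    [∀ m, CompleteSpace (Y m)]
    -- the operators `A`, `B`, `closure (A + B)` and the semigroups generated by them
    (A B : X →ₗ.[ℂ] X) (T S U : ℝ → X →L[ℂ] X)
    (hA_closed : A.IsClosed) (hA_dense : Dense (A.domain : Set X))
    (hB_closed : B.IsClosed) (hB_dense : Dense (B.domain : Set X))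
    (hT : IsC0Semigroup T) (hAT : IsGenerator A T)
    (hS : IsC0Semigroup S) (hBS : IsGenerator B S)
    (hAB : (A + B).IsClosable)
    (hU : IsC0Semigroup U) (hABU : IsGenerator (A + B).closure U)
    -- the spatial discretization
    (P : ∀ m, X →L[ℂ] Y m) (J : ∀ m, Y m →L[ℂ] X)
    (hPJ : ∀ m, (P m).comp (J m) = ContinuousLinearMap.id ℂ (Y m))
    (hJP : ∀ x : X, Tendsto (fun m => J m (P m x)) atTop (𝓝 x))
    (K : ℝ) (hJK : ∀ m, ‖J m‖ ≤ K) (hPK : ∀ m, ‖P m‖ ≤ K)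
    -- the approximating operators: stability
    (A' B' : ∀ m, Y m →ₗ.[ℂ] Y m) (M₀ : ℝ)
    (hA_stab : ResolventBound A M₀) (hA'_stab : ∀ m, ResolventBound (A' m) M₀)
    (hB_stab : ResolventBound B M₀) (hB'_stab : ∀ m, ResolventBound (B' m) M₀)
    -- the approximating operators: consistency
    (hPA : ∀ m, ∀ x ∈ A.domain, P m x ∈ (A' m).domain)
    (hPB : ∀ m, ∀ x ∈ B.domain, P m x ∈ (B' m).domain)
    (hA_cons : ∀ x : A.domain,
      Tendsto (fun m => J m (A' m ⟨P m x, hPA m x x.2⟩)) atTop (𝓝 (A x)))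
    (hB_cons : ∀ x : B.domain,
      Tendsto (fun m => J m (B' m ⟨P m x, hPB m x x.2⟩)) atTop (𝓝 (B x)))
    -- the rational functions
    (r q : RatFunc ℂ)
    (hr : ApproximatesExp r) (hr_bdd : BoundedOnLeftHalfPlane r)
    (hq : ApproximatesExp q) (hq_bdd : BoundedOnLeftHalfPlane q) :
    -- Strang splitting
    ((∃ M ω : ℝ, ∀ h : ℝ, 0 ≤ h → ∀ k m : ℕ,
        ‖(ratOp r (h / 2) (A' m) * ratOp q h (B' m) * ratOp r (h / 2) (A' m)) ^ k‖
          ≤ M * Real.exp (k * h * ω)) →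
      ∀ t : ℝ, 0 ≤ t → ∀ x : X,
        Tendsto (fun i : ℕ × ℕ => J i.1
          (((ratOp r (t / (2 * i.2)) (A' i.1) * ratOp q (t / i.2) (B' i.1) *
            ratOp r (t / (2 * i.2)) (A' i.1)) ^ i.2) (P i.1 x)))
          (atTop ×ˢ atTop) (𝓝 (U t x))) ∧
    -- weighted splitting
    (∀ Θ : ℝ, 0 ≤ Θ → Θ ≤ 1 →
      (∃ M ω : ℝ, ∀ h : ℝ, 0 ≤ h → ∀ k m : ℕ,
        ‖((Θ : ℂ) • (ratOp q h (B' m) * ratOp r h (A' m)) +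
            ((1 - Θ : ℝ) : ℂ) • (ratOp r h (A' m) * ratOp q h (B' m))) ^ k‖
          ≤ M * Real.exp (k * h * ω)) →
      ∀ t : ℝ, 0 ≤ t → ∀ x : X,
        Tendsto (fun i : ℕ × ℕ => J i.1
          ((((Θ : ℂ) • (ratOp q (t / i.2) (B' i.1) * ratOp r (t / i.2) (A' i.1)) +
            ((1 - Θ : ℝ) : ℂ) • (ratOp r (t / i.2) (A' i.1) * ratOp q (t / i.2) (B' i.1))) ^ i.2)
            (P i.1 x)))
          (atTop ×ˢ atTop) (𝓝 (U t x))) := by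
  have hAd : ∀ x : A.domain, DConv ((atTop : Filter ℕ) ×ˢ (atTop : Filter ℕ)) (fun i => P i.1)
      (fun i => A' i.1 ⟨P i.1 x, hPA i.1 x x.2⟩) (A x) := fun x =>
    dConv_of_tendsto hPJ hPK (y := fun m => A' m ⟨P m x, hPA m x x.2⟩) (hA_cons x)
  have hBd : ∀ x : B.domain, DConv ((atTop : Filter ℕ) ×ˢ (atTop : Filter ℕ)) (fun i => P i.1)
      (fun i => B' i.1 ⟨P i.1 x, hPB i.1 x x.2⟩) (B x) := fun x =>
    dConv_of_tendsto hPJ hPK (y := fun m => B' m ⟨P m x, hPB m x x.2⟩) (hB_cons x)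
  have hP' : ∀ i : ℕ × ℕ, ‖P i.1‖ ≤ K := fun i => hPK i.1
  have hrI := fun (h : ℕ × ℕ → ℝ) => tendstoId_ratOp (h := h) hr hr_bdd hP' hA_dense
    (fun i => hA'_stab i.1) (fun i => hPA i.1) hAd
  have hqI := fun (h : ℕ × ℕ → ℝ) => tendstoId_ratOp (h := h) hq hq_bdd hP' hB_dense
    (fun i => hB'_stab i.1) (fun i => hPB i.1) hBd
  have hrC := fun (h : ℕ × ℕ → ℝ) => consistentAt_ratOp (h := h) hr hr_bdd hP' hA_dense
    (fun i => hA'_stab i.1) (fun i => hPA i.1) hAd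
  have hqC := fun (h : ℕ × ℕ → ℝ) => consistentAt_ratOp (h := h) hq hq_bdd hP' hB_dense
    (fun i => hB'_stab i.1) (fun i => hPB i.1) hBd
  refine ⟨fun hstab t ht x => ?_, fun Θ _ _ hstab t ht x => ?_⟩
  · have key := tendsto_pow_of_consistentAt (V := fun h m => ratOp r (h / 2) (A' m) *
      ratOp q h (B' m) * ratOp r (h / 2) (A' m)) hAB hU hABU hJP hJK hPK
      (fun m => by simp [ratOp_zero hr hr_bdd, ratOp_zero hq hq_bdd])
      (fun h hpos hlim x hxA hxB => ?_) hstab ht x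
    · refine key.congr fun i => ?_
      rw [div_div, mul_comm (i.2 : ℝ) 2]
    · have hpos' : ∀ᶠ i in atTop ×ˢ atTop, 0 < h i / 2 := hpos.mono fun i hi => half_pos hi
      have hlim' : Tendsto (fun i => h i / 2) (atTop ×ˢ atTop) (𝓝 0) := by
        simpa using hlim.div_const 2
      have h1 := (hrC (fun i => h i / 2) hpos' hlim' ⟨x, hxA⟩).congr_step (h' := h) (1 / 2)
        (fun i => by ring) (by norm_num)
      have hI := hrI (fun i => h i / 2) hpos' hlim'
      -- The product rule adds the contributions `A / 2`, `B` and `A / 2` of the three factors.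
      have h2 := ConsistentAt.mul (hI.mul (hqI h hpos hlim))
        (ConsistentAt.mul hI h1 (hqC h hpos hlim ⟨x, hxB⟩)) h1
      have e : ((1 / 2 : ℝ) : ℂ) • A ⟨x, hxA⟩ + B ⟨x, hxB⟩ + ((1 / 2 : ℝ) : ℂ) • A ⟨x, hxA⟩ =
          A ⟨x, hxA⟩ + B ⟨x, hxB⟩ := by
        push_cast
        module
      rw [e] at h2
      exact h2
  · have hΘ : (Θ : ℂ) + ((1 - Θ : ℝ) : ℂ) = 1 := by push_cast; ring
    refine tendsto_pow_of_consistentAt (V := fun h m => (Θ : ℂ) • (ratOp q h (B' m) *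
      ratOp r h (A' m)) + ((1 - Θ : ℝ) : ℂ) • (ratOp r h (A' m) * ratOp q h (B' m)))
      hAB hU hABU hJP hJK hPK
      (fun m => ?_) (fun h hpos hlim x hxA hxB => ?_) hstab ht x
    · rw [ratOp_zero hr hr_bdd, ratOp_zero hq hq_bdd, mul_one, ← add_smul, hΘ, one_smul]
    · have h1 := hrC h hpos hlim ⟨x, hxA⟩
      have h2 := hqC h hpos hlim ⟨x, hxB⟩
      -- Both orders of composition have the same first-order limit `A x + B x`, so their weighted
      -- mean does too.
      have h3 := ConsistentAt.mul (hqI h hpos hlim) h2 h1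
      rw [add_comm] at h3
      exact ConsistentAt.weighted hΘ h3 (ConsistentAt.mul (hrI h hpos hlim) h1 h2)
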